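/- **Setting.** Let $M$ be a finite-dimensional smooth (Hausdorff) manifold with a smooth torsion-free affine connection $\nabla$ such that for every $x\in M$ the exponential map $\exp_x$ is defined on all of $T_xM$ and maps it onto $M$. A set $C\subseteq M$ is convex if every geodesic $\gamma:[a,b]\to M$ with end points in $C$ stays in $C$. For a smooth function $f$ put $Hf(X,Y)=X(Df(Y))-Df(\nabla_XY)$ and $(\nabla_XHf)(Y,Z)=X(Hf(Y,Z))-Hf(\nabla_XY,Z)-Hf(Y,\nabla_XZ)$. Let $\sigma>0$. Let $C\subseteq M$ be open and convex and let $f:C\to\mathbb R$ be *weakly $\sigma$-self-concordant* ($\sigma$-WSC): $f$ is smooth, convex along geodesics, closed (its epigraph $\{(x,y): x\in C,\ y\ge f(x)\}$ is closed in $M\times\mathbb R$), nondegenerate ($Hf_x$ is positive definite for all $x\in C$), and $$|(\nabla_uHf)(u,u)|\le 2\sigma\,Hf_x(u,u)^{3/2}\qquad(x\in C,\ u\in T_xM).$$ For $x\in C$ let $\bar u\in T_xM$ be the Newton direction, i.e. the solution of $Df_x(\cdot)+Hf_x(\bar u,\cdot)=0$, let $\lambda_f(x)=Hf_x(\bar u,\bar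 u)^{1/2}$ be the Newton decrement, and let $x^+=\exp_x\!\big(\bar u/(1+\sigma\lambda_f(x))\big)$ be the damped Newton update. Let $\omega(t)=t-\log(1+t)$. **Proposition.** For every $x\in C$ the Newton direction exists, $x^+\in C$, and $$f(x^+)\le f(x)-\frac1{\sigma^2}\,\omega(\sigma\lambda_f(x)).$$ Consequently, if $f$ is bounded below on $C$ and $f^*=\inf_Cf$, then for every $x_0\in C$ and every $\beta>0$ the damped Newton iteration $x_{k+1}=x_k^+$ reaches a point $x_k\in C$ with $\lambda_f(x_k)<\beta/\sigma$ after some number $$k\le\frac{\sigma^2\,(f(x_0)-f^*)}{\omega(\beta)}$$ of iterations (so in $O(\sigma^2(f(x_0)-f^*)/\omega(\beta))$ iterations, with constant $1$). -/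

import Mathlib

open Bundle Set
open scoped Manifold ContDiff Topology

noncomputable section

namespace SelfConcordance

variable {E : Type*} [NormedAddCommGroup E] [NormedSpace ℝ E]
  {M : Type*} [TopologicalSpace M] [ChartedSpace E M] [IsManifold 𝓘(ℝ, E) ∞ M]

/-! ### Curves, geodesics and the exponential map of an affine connection

In Mathlib's convention `cov Y x u` is the covariant derivative `∇_u Y` at `x`. -/

/-- The tangent vector `γ'(t)` of a curve `γ` with domain `s` (one-sided at end points of `s`). -/
def velocity (γ : ℝ → M) (s : Set ℝ) (t : ℝ) : TangentSpace 𝓘(ℝ, E) (γ t) :=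
  mfderivWithin 𝓘(ℝ, ℝ) 𝓘(ℝ, E) γ s t (1 : ℝ)

/-- The covariant derivative at time `t` of a vector field `V` along the curve `γ` with domain `s`.
In the frame of the tangent bundle given by the preferred chart at `γ t` it is the usual
`dVᵏ/dt + Γᵏᵢⱼ(γ) (γ')ⁱ Vʲ`: the first summand differentiates the coordinates of `V`, and the second
one is `∇_{γ'(t)}` of the vector field near `γ t` that has constant coordinates equal to those
of `V t` (this field is `FiberBundle.extend E (V t)`). -/
def covDerivAlong (cov : CovariantDerivative 𝓘(ℝ, E) E (TangentSpace 𝓘(ℝ, E) : M → Type _))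
    (γ : ℝ → M) (V : ∀ t : ℝ, TangentSpace 𝓘(ℝ, E) (γ t)) (s : Set ℝ) (t : ℝ) :
    TangentSpace 𝓘(ℝ, E) (γ t) :=
  (trivializationAt E (TangentSpace 𝓘(ℝ, E)) (γ t)).symm (γ t)
      (derivWithin
        (fun r => (trivializationAt E (TangentSpace 𝓘(ℝ, E)) (γ t) ⟨γ r, V r⟩).2) s t)
    + cov (FiberBundle.extend E (V t)) (γ t) (velocity γ s t)

/-- `γ` is a geodesic with domain `s`: a smooth curve whose tangent vector is parallel along it. -/
structure IsGeodesicOn (cov : CovariantDerivative 𝓘(ℝ, E) E (TangentSpace 𝓘(ℝ, E) : M → Type _))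
    (γ : ℝ → M) (s : Set ℝ) : Prop where
  contMDiffOn : ContMDiffOn 𝓘(ℝ, ℝ) 𝓘(ℝ, E) ∞ γ s
  parallel : ∀ t ∈ s, covDerivAlong cov γ (velocity γ s) s t = 0

/-- `γ : [0,1] → M` is a geodesic with `γ(0) = x` and `γ'(0) = u`. -/
def IsGeodesicFrom (cov : CovariantDerivative 𝓘(ℝ, E) E (TangentSpace 𝓘(ℝ, E) : M → Type _))
    (x : M) (u : TangentSpace 𝓘(ℝ, E) x) (γ : ℝ → M) : Prop :=
  IsGeodesicOn cov γ (Icc 0 1) ∧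
    (⟨γ 0, velocity γ (Icc 0 1) 0⟩ : TangentBundle 𝓘(ℝ, E) M) = ⟨x, u⟩

open Classical in
/-- The exponential map: `exp_x u = γ(1)` for the geodesic `γ` with `γ(0) = x`, `γ'(0) = u`
(the value is `x` if there is no such geodesic on `[0,1]`). -/
def expMap (cov : CovariantDerivative 𝓘(ℝ, E) E (TangentSpace 𝓘(ℝ, E) : M → Type _))
    (x : M) (u : TangentSpace 𝓘(ℝ, E) x) : M :=
  if h : ∃ γ : ℝ → M, IsGeodesicFrom cov x u γ then h.choose 1 else x

/-- The exponential map at `x` is defined on the whole tangent space at `x`. -/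
def ExpDefinedAt (cov : CovariantDerivative 𝓘(ℝ, E) E (TangentSpace 𝓘(ℝ, E) : M → Type _))
    (x : M) : Prop :=
  ∀ u : TangentSpace 𝓘(ℝ, E) x, ∃ γ : ℝ → M, IsGeodesicFrom cov x u γ

/-- Geodesic convexity of a set. -/
def IsGeodesicallyConvex
    (cov : CovariantDerivative 𝓘(ℝ, E) E (TangentSpace 𝓘(ℝ, E) : M → Type _)) (C : Set M) : Prop :=
  ∀ (γ : ℝ → M) (a b : ℝ), a ≤ b → IsGeodesicOn cov γ (Icc a b) → γ a ∈ C → γ b ∈ C →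
    ∀ t ∈ Icc a b, γ t ∈ C

/-- Convexity of a function on `C` along all geodesics in `C`. -/
def GeodesicallyConvexOn
    (cov : CovariantDerivative 𝓘(ℝ, E) E (TangentSpace 𝓘(ℝ, E) : M → Type _))
    (C : Set M) (f : M → ℝ) : Prop :=
  ∀ (γ : ℝ → M) (a b : ℝ), IsGeodesicOn cov γ (Icc a b) → MapsTo γ (Icc a b) C →
    ConvexOn ℝ (Icc a b) (f ∘ γ)

/-! ### The Hessian and its covariant derivative -/

/-- `Hf(U, V) = U(Df(V)) - Df(∇_U V)` at `x`, where `V` is any local vector field extending `v`. -/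
def hessian (cov : CovariantDerivative 𝓘(ℝ, E) E (TangentSpace 𝓘(ℝ, E) : M → Type _))
    (f : M → ℝ) (x : M) (u v : TangentSpace 𝓘(ℝ, E) x) : ℝ :=
  mvfderiv 𝓘(ℝ, E) (fun y => mvfderiv 𝓘(ℝ, E) f y (FiberBundle.extend E v y)) x u
    - mvfderiv 𝓘(ℝ, E) f x (cov (FiberBundle.extend E v) x u)

/-- `(∇_U Hf)(V, W) = U(Hf(V, W)) - Hf(∇_U V, W) - Hf(V, ∇_U W)` at `x`, where `V`, `W` are any
local vector fields extending `v`, `w`. -/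
def covDerivHessian (cov : CovariantDerivative 𝓘(ℝ, E) E (TangentSpace 𝓘(ℝ, E) : M → Type _))
    (f : M → ℝ) (x : M) (u v w : TangentSpace 𝓘(ℝ, E) x) : ℝ :=
  mvfderiv 𝓘(ℝ, E)
      (fun y => hessian cov f y (FiberBundle.extend E v y) (FiberBundle.extend E w y)) x u
    - hessian cov f x (cov (FiberBundle.extend E v) x u) w
    - hessian cov f x v (cov (FiberBundle.extend E w) x u)

/-- The local norm `‖u‖_{f,x} = Hf_x(u,u)^{1/2}`. -/
def localNorm (cov : CovariantDerivative 𝓘(ℝ, E) E (TangentSpace 𝓘(ℝ, E) : M → Type _))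
    (f : M → ℝ) (x : M) (u : TangentSpace 𝓘(ℝ, E) x) : ℝ :=
  √(hessian cov f x u u)

/-! ### Weakly self-concordant functions -/

/-- `f : C → ℝ` is weakly `σ`-self-concordant. The values of `f` outside the open set `C` play no
role; `f` is thought of as `+∞` there. -/
structure IsWeaklySelfConcordant
    (cov : CovariantDerivative 𝓘(ℝ, E) E (TangentSpace 𝓘(ℝ, E) : M → Type _))
    (C : Set M) (f : M → ℝ) (σ : ℝ) : Prop where
  isOpen : IsOpen C
  convex_domain : IsGeodesicallyConvex cov C
  smooth : ContMDiffOn 𝓘(ℝ, E) 𝓘(ℝ, ℝ) ∞ f C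
  convex : GeodesicallyConvexOn cov C f
  /-- The epigraph is closed in `M × ℝ`. -/
  closed : IsClosed {p : M × ℝ | p.1 ∈ C ∧ f p.1 ≤ p.2}
  nondegenerate : ∀ x ∈ C, ∀ u : TangentSpace 𝓘(ℝ, E) x, u ≠ 0 → 0 < hessian cov f x u u
  nonneg : 0 ≤ σ
  bound : ∀ x ∈ C, ∀ u : TangentSpace 𝓘(ℝ, E) x,
    |covDerivHessian cov f x u u u| ≤ 2 * σ * (hessian cov f x u u) ^ (3 / 2 : ℝ)

/-! ### The damped Newton method -/

/-- `u` solves the Newton equation `Df_x(·) + Hf_x(u, ·) = 0`. -/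
def IsNewtonDirection (cov : CovariantDerivative 𝓘(ℝ, E) E (TangentSpace 𝓘(ℝ, E) : M → Type _))
    (f : M → ℝ) (x : M) (u : TangentSpace 𝓘(ℝ, E) x) : Prop :=
  ∀ v : TangentSpace 𝓘(ℝ, E) x, mvfderiv 𝓘(ℝ, E) f x v + hessian cov f x u v = 0

open Classical in
/-- The Newton direction at `x` (with value `0` if the Newton equation has no solution). -/
def newtonDirection (cov : CovariantDerivative 𝓘(ℝ, E) E (TangentSpace 𝓘(ℝ, E) : M → Type _))
    (f : M → ℝ) (x : M) : TangentSpace 𝓘(ℝ, E) x :=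
  if h : ∃ u : TangentSpace 𝓘(ℝ, E) x, IsNewtonDirection cov f x u then h.choose else 0

/-- The Newton decrement `λ_f(x)`, the local norm of the Newton direction. -/
def newtonDecrement (cov : CovariantDerivative 𝓘(ℝ, E) E (TangentSpace 𝓘(ℝ, E) : M → Type _))
    (f : M → ℝ) (x : M) : ℝ :=
  localNorm cov f x (newtonDirection cov f x)

/-- The damped Newton update `x ↦ exp_x (ū / (1 + σ λ_f(x)))`. -/
def dampedNewton (cov : CovariantDerivative 𝓘(ℝ, E) E (TangentSpace 𝓘(ℝ, E) : M → Type _))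
    (σ : ℝ) (f : M → ℝ) (x : M) : M :=
  expMap cov x ((1 + σ * newtonDecrement cov f x)⁻¹ • newtonDirection cov f x)

/-- `ω(t) = t - log (1 + t)`. -/
def omega (t : ℝ) : ℝ := t - Real.log (1 + t)

end SelfConcordance

end

/-! Along a geodesic γ the velocity is parallel, so φ = f ∘ γ has φ' = Df(γ'), φ'' = Hf(γ', γ') and
φ''' = (∇Hf)(γ', γ', γ') (`IsGeodesicOn.hasDerivWithinAt_mvfderiv`,
`IsGeodesicOn.hasDerivWithinAt_hessian`). Weak self-concordance becomes the scalar inequality |φ'''|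
≤ 2σ(φ'')^(3/2). Comparison with the solution (r/(1 - σrt))² of q' = 2σq^(3/2), integrated twice,
bounds φ above (`le_of_abs_third_deriv_le`).

This bound holds only while γ stays in C, but it is finite on [0,1] if σr < 1, and a closed epigraph
forbids leaving C while f is bounded by a continuous function (`mem_of_isClosed_epigraph`). The
damped step has r = cλ and φ'(0) = -cλ² with c = 1/(1 + σλ); then 1 - σr = c, and the bound
simplifies to f(x) - ω(σλ)/σ². Since ω is increasing, every step with λ ≥ β/σ gains at least
ω(β)/σ², which bounds the number of such steps. -/

/-! ### Differentiating multilinear expressions -/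

section Multilinear

variable {E : Type*} [NormedAddCommGroup E] [NormedSpace ℝ E] [FiniteDimensional ℝ E]

/-- Expand `c r - c t` in a basis: its coordinates vanish at `t`, so the derivatives of `ℓ r (b i)`
drop out of the product rule. Hence `ℓ'` need not be linear. -/
theorem HasDerivWithinAt.linearMap_apply_of_pointwise {ℓ : ℝ → E →ₗ[ℝ] ℝ} {c : ℝ → E} {c' : E}
    {ℓ' : E → ℝ} {s : Set ℝ} {t : ℝ} (hc : HasDerivWithinAt c c' s t)
    (hℓ : ∀ a, HasDerivWithinAt (fun r => ℓ r a) (ℓ' a) s t) :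
    HasDerivWithinAt (fun r => ℓ r (c r)) (ℓ' (c t) + ℓ t c') s t := by
  let b := Module.finBasis ℝ E
  have hcoord : ∀ i, HasDerivWithinAt (fun r => b.repr (c r - c t) i) (b.repr c' i) s t := by
    intro i
    exact (LinearMap.toContinuousLinearMap (b.coord i)).hasFDerivAt.comp_hasDerivWithinAt t
      (hc.sub_const (c t))
  have hexp : ∀ r v, ℓ r v = ∑ i, b.repr v i * ℓ r (b i) := by
    intro r v
    conv_lhs => rw [← b.sum_repr v, map_sum]
    simp only [map_smul, smul_eq_mul]
  have hsum : HasDerivWithinAt (fun r => ∑ i, b.repr (c r - c t) i * ℓ r (b i))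
      (∑ i, b.repr c' i * ℓ t (b i)) s t := by
    refine HasDerivWithinAt.fun_sum fun i _ => ?_
    have := (hcoord i).fun_mul (hℓ (b i))
    simpa using this
  have := (hℓ (c t)).fun_add hsum
  rw [← hexp] at this
  refine this.congr_of_eventuallyEq ?_ ?_
  · exact Filter.Eventually.of_forall fun r => by
      change ℓ r (c r) = ℓ r (c t) + ∑ i, b.repr (c r - c t) i * ℓ r (b i)
      rw [← hexp, map_sub, add_sub_cancel]
  · simp

theorem HasDerivWithinAt.bilinearMap_apply_of_pointwise {h : ℝ → E →ₗ[ℝ] E →ₗ[ℝ] ℝ} {c : ℝ → E}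
    {c' : E} {h' : E → E → ℝ} {s : Set ℝ} {t : ℝ} (hc : HasDerivWithinAt c c' s t)
    (hh : ∀ a b, HasDerivWithinAt (fun r => h r a b) (h' a b) s t) :
    HasDerivWithinAt (fun r => h r (c r) (c r))
      (h' (c t) (c t) + h t (c t) c' + h t c' (c t)) s t := by
  have h1 : ∀ a, HasDerivWithinAt (fun r => (h r).flip (c r) a) (h' a (c t) + h t a c') s t :=
    fun a => hc.linearMap_apply_of_pointwise (ℓ := fun r => h r a) (hh a)
  exact hc.linearMap_apply_of_pointwise (ℓ := fun r => (h r).flip (c r)) h1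

end Multilinear

namespace SelfConcordance

variable {E : Type*} [NormedAddCommGroup E] [NormedSpace ℝ E]
  {M : Type*} [TopologicalSpace M] [ChartedSpace E M] [IsManifold 𝓘(ℝ, E) ∞ M]

/-! ### Derivatives of functions along vector fields -/

omit [IsManifold 𝓘(ℝ, E) ∞ M] in
theorem mvfderiv_eq_snd_tangentMapWithin {g : M → ℝ} {U : Set M} (hU : IsOpen U) {y : M}
    (hy : y ∈ U) (v : TangentSpace 𝓘(ℝ, E) y) :
    mvfderiv 𝓘(ℝ, E) g y v
      = (tangentMapWithin 𝓘(ℝ, E) 𝓘(ℝ, ℝ) g U (⟨y, v⟩ : TangentBundle 𝓘(ℝ, E) M)).2 := by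
  simp only [tangentMapWithin, mfderivWithin_of_isOpen hU hy]
  rfl

theorem contMDiffOn_mvfderiv {g : M → ℝ} {U : Set M} (hU : IsOpen U)
    (hg : ContMDiffOn 𝓘(ℝ, E) 𝓘(ℝ, ℝ) ∞ g U) {V : ∀ y : M, TangentSpace 𝓘(ℝ, E) y}
    (hV : ContMDiffOn 𝓘(ℝ, E) (𝓘(ℝ, E).prod 𝓘(ℝ, E)) ∞
      (fun y => (⟨y, V y⟩ : TangentBundle 𝓘(ℝ, E) M)) U) :
    ContMDiffOn 𝓘(ℝ, E) 𝓘(ℝ, ℝ) ∞ (fun y => mvfderiv 𝓘(ℝ, E) g y (V y)) U := by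
  have h1 := hg.contMDiffOn_tangentMapWithin (m := ∞) le_rfl hU.uniqueMDiffOn
  have h2 := (contMDiff_snd_tangentBundle_modelSpace (n := ∞) ℝ 𝓘(ℝ, ℝ)).comp_contMDiffOn
    (h1.comp hV fun y hy => hy)
  exact h2.congr fun y hy => mvfderiv_eq_snd_tangentMapWithin hU hy (V y)

/-- The map (y, v) ↦ Dg_y(v) is smooth on the part of the tangent bundle over `U`, so
differentiability of `V` at the single point `x` suffices. Tensoriality is tested on such fields. -/
theorem mdifferentiableAt_mvfderiv {g : M → ℝ} {U : Set M} (hU : IsOpen U)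
    (hg : ContMDiffOn 𝓘(ℝ, E) 𝓘(ℝ, ℝ) ∞ g U) {x : M} (hx : x ∈ U)
    {V : ∀ y : M, TangentSpace 𝓘(ℝ, E) y}
    (hV : MDifferentiableAt 𝓘(ℝ, E) (𝓘(ℝ, E).prod 𝓘(ℝ, E))
      (fun y => (⟨y, V y⟩ : TangentBundle 𝓘(ℝ, E) M)) x) :
    MDifferentiableAt 𝓘(ℝ, E) 𝓘(ℝ, ℝ) (fun y => mvfderiv 𝓘(ℝ, E) g y (V y)) x := by
  have h1 := hg.contMDiffOn_tangentMapWithin (m := ∞) le_rfl hU.uniqueMDiffOn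
  have h2 := (contMDiff_snd_tangentBundle_modelSpace (n := ∞) ℝ 𝓘(ℝ, ℝ)).comp_contMDiffOn h1
  have hpre : TotalSpace.proj ⁻¹' U ∈ 𝓝 (⟨x, V x⟩ : TangentBundle 𝓘(ℝ, E) M) :=
    (hU.preimage (FiberBundle.continuous_proj E _)).mem_nhds hx
  have h3 := ((h2.contMDiffAt hpre).mdifferentiableAt (by simp)).comp x hV
  refine h3.congr_of_eventuallyEq ?_
  filter_upwards [hU.mem_nhds hx] with y hy
  exact mvfderiv_eq_snd_tangentMapWithin hU hy (V y)

/-! ### Tensoriality of the Hessian -/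

section Hessian

variable [FiniteDimensional ℝ E]
  (cov : CovariantDerivative 𝓘(ℝ, E) E (TangentSpace 𝓘(ℝ, E) : M → Type _))

omit [FiniteDimensional ℝ E] in
-- For `g • W` both terms produce u(g)·Df(W), and these cancel.
theorem tensorialAt_hessian {f : M → ℝ} {C : Set M} (hC : IsOpen C)
    (hf : ContMDiffOn 𝓘(ℝ, E) 𝓘(ℝ, ℝ) ∞ f C) {x : M} (hx : x ∈ C) (u : TangentSpace 𝓘(ℝ, E) x) :
    TensorialAt 𝓘(ℝ, E) E (V := (TangentSpace 𝓘(ℝ, E) : M → Type _))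
      (fun W => mvfderiv 𝓘(ℝ, E) (fun y => mvfderiv 𝓘(ℝ, E) f y (W y)) x u
        - mvfderiv 𝓘(ℝ, E) f x (cov W x u)) x where
  smul {g W} hg hW := by
    have hd := mdifferentiableAt_mvfderiv hC hf hx hW
    have h1 : (fun y => mvfderiv 𝓘(ℝ, E) f y ((g • W) y))
        = fun y => g y * mvfderiv 𝓘(ℝ, E) f y (W y) := by
      ext y; simp
    rw [h1, mvfderiv_fun_mul hg hd, cov.isCovariantDerivativeOnUniv.leibniz hW hg]
    simp
    ring
  add {W W'} hW hW' := by
    have h1 : (fun y => mvfderiv 𝓘(ℝ, E) f y ((W + W') y))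
        = fun y => mvfderiv 𝓘(ℝ, E) f y (W y) + mvfderiv 𝓘(ℝ, E) f y (W' y) := by
      ext y; simp
    rw [h1, mvfderiv_fun_add (mdifferentiableAt_mvfderiv hC hf hx hW)
      (mdifferentiableAt_mvfderiv hC hf hx hW'), cov.isCovariantDerivativeOnUniv.add hW hW']
    simp
    ring

theorem hessian_eq {f : M → ℝ} {C : Set M} (hC : IsOpen C)
    (hf : ContMDiffOn 𝓘(ℝ, E) 𝓘(ℝ, ℝ) ∞ f C) {x : M} (hx : x ∈ C) (u : TangentSpace 𝓘(ℝ, E) x)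
    {W : ∀ y : M, TangentSpace 𝓘(ℝ, E) y}
    (hW : MDifferentiableAt 𝓘(ℝ, E) (𝓘(ℝ, E).prod 𝓘(ℝ, E))
      (fun y => (⟨y, W y⟩ : TangentBundle 𝓘(ℝ, E) M)) x) :
    hessian cov f x u (W x) = mvfderiv 𝓘(ℝ, E) (fun y => mvfderiv 𝓘(ℝ, E) f y (W y)) x u
        - mvfderiv 𝓘(ℝ, E) f x (cov W x u) :=
  (tensorialAt_hessian cov hC hf hx u).mkHom_apply hW

/-- The Hessian at a point as a bilinear map. -/
noncomputable def hessianBilin {f : M → ℝ} {C : Set M} (hC : IsOpen C)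
    (hf : ContMDiffOn 𝓘(ℝ, E) 𝓘(ℝ, ℝ) ∞ f C) {x : M} (hx : x ∈ C) :
    TangentSpace 𝓘(ℝ, E) x →ₗ[ℝ] TangentSpace 𝓘(ℝ, E) x →ₗ[ℝ] ℝ :=
  LinearMap.mk₂ ℝ (hessian cov f x)
    (fun u u' v => by simp [hessian]; ring)
    (fun c u v => by simp [hessian]; ring)
    -- Linearity in the second slot is not visible from the formula, which extends `v` to a field;
    -- tensoriality supplies it.
    (fun u v v' => ((tensorialAt_hessian cov hC hf hx u).mkHom).map_add v v')
    (fun c u v => ((tensorialAt_hessian cov hC hf hx u).mkHom).map_smul c v)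

end Hessian

end SelfConcordance

namespace SelfConcordance

variable {E : Type*} [NormedAddCommGroup E] [NormedSpace ℝ E] [FiniteDimensional ℝ E]
  {M : Type*} [TopologicalSpace M] [ChartedSpace E M] [IsManifold 𝓘(ℝ, E) ∞ M]
  (cov : CovariantDerivative 𝓘(ℝ, E) E (TangentSpace 𝓘(ℝ, E) : M → Type _))

/-! ### Differentiability of the Hessian in a local frame -/

/-- A bump function cuts off `FiberBundle.extend`, whose smoothness is used only near `x`;
`contMDiffOn_hessian` needs global fields. -/
theorem exists_contMDiff_eventuallyEq_extend [T2Space M] {x : M} (v : TangentSpace 𝓘(ℝ, E) x) :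
    ∃ W : ∀ y : M, TangentSpace 𝓘(ℝ, E) y,
      ContMDiff 𝓘(ℝ, E) (𝓘(ℝ, E).prod 𝓘(ℝ, E)) ∞
        (fun y => (⟨y, W y⟩ : TangentBundle 𝓘(ℝ, E) M)) ∧
      ∀ᶠ y in 𝓝 x, FiberBundle.extend E v y = W y := by
  obtain ⟨s, hs, hsV⟩ := FiberBundle.exists_contMDiffOn_extend (k := ∞) 𝓘(ℝ, E) E v
  obtain ⟨ψ, -, hψ⟩ := (SmoothBumpFunction.nhds_basis_tsupport (I := 𝓘(ℝ, E)) x).mem_iff.1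
    (interior_mem_nhds.2 hs)
  refine ⟨(ψ : M → ℝ) • FiberBundle.extend E v,
    ContMDiffOn.smul_section_of_tsupport ψ.contMDiff.contMDiffOn isOpen_interior hψ
      (hsV.mono interior_subset), ?_⟩
  filter_upwards [ψ.eventuallyEq_one] with y hy
  simp [hy]

theorem contMDiffOn_hessian [cov.ContMDiffCovariantDerivative ∞] {f : M → ℝ} {C : Set M}
    (hC : IsOpen C) (hf : ContMDiffOn 𝓘(ℝ, E) 𝓘(ℝ, ℝ) ∞ f C)
    {V W : ∀ y : M, TangentSpace 𝓘(ℝ, E) y}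
    (hV : ContMDiff 𝓘(ℝ, E) (𝓘(ℝ, E).prod 𝓘(ℝ, E)) ∞
        (fun y => (⟨y, V y⟩ : TangentBundle 𝓘(ℝ, E) M)))
    (hW : ContMDiff 𝓘(ℝ, E) (𝓘(ℝ, E).prod 𝓘(ℝ, E)) ∞
        (fun y => (⟨y, W y⟩ : TangentBundle 𝓘(ℝ, E) M))) :
    ContMDiffOn 𝓘(ℝ, E) 𝓘(ℝ, ℝ) ∞ (fun y => hessian cov f y (V y) (W y)) C := by
  have hcov := (CovariantDerivative.ContMDiffCovariantDerivative.contMDiff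
    (cov := cov) (k := ∞)).contMDiff (σ := W) hW.contMDiffOn
  have hcovVW := ContMDiffOn.clm_bundle_apply hcov hV.contMDiffOn
  have h1 := contMDiffOn_mvfderiv hC (contMDiffOn_mvfderiv hC hf hW.contMDiffOn) hV.contMDiffOn
  have h2 := contMDiffOn_mvfderiv hC hf (hcovVW.mono (subset_univ C))
  exact (h1.sub h2).congr fun y hy =>
    hessian_eq cov hC hf hy (V y) (hW.mdifferentiable (by simp) y)

theorem mdifferentiableAt_hessian_extend [T2Space M] [cov.ContMDiffCovariantDerivative ∞]
    {f : M → ℝ} {C : Set M} (hC : IsOpen C) (hf : ContMDiffOn 𝓘(ℝ, E) 𝓘(ℝ, ℝ) ∞ f C)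
    {x : M} (hx : x ∈ C) (v w : TangentSpace 𝓘(ℝ, E) x) :
    MDifferentiableAt 𝓘(ℝ, E) 𝓘(ℝ, ℝ)
      (fun y => hessian cov f y (FiberBundle.extend E v y) (FiberBundle.extend E w y)) x := by
  obtain ⟨V, hV, hVv⟩ := exists_contMDiff_eventuallyEq_extend v
  obtain ⟨W, hW, hWw⟩ := exists_contMDiff_eventuallyEq_extend w
  refine (((contMDiffOn_hessian cov hC hf hV hW).contMDiffAt (hC.mem_nhds hx)).mdifferentiableAt
    (by simp)).congr_of_eventuallyEq ?_
  filter_upwards [hVv, hWw] with y h1 h2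
  rw [h1, h2]

/-! ### Curves -/

omit [FiniteDimensional ℝ E] [IsManifold 𝓘(ℝ, E) ∞ M] in
theorem hasDerivWithinAt_comp_curve {g : M → ℝ} {γ : ℝ → M} {s : Set ℝ} {t : ℝ}
    (hg : MDifferentiableAt 𝓘(ℝ, E) 𝓘(ℝ, ℝ) g (γ t))
    (hγ : MDifferentiableWithinAt 𝓘(ℝ, ℝ) 𝓘(ℝ, E) γ s t) :
    HasDerivWithinAt (fun r => g (γ r)) (mvfderiv 𝓘(ℝ, E) g (γ t) (velocity γ s t)) s t := by
  have h := hg.hasMFDerivAt.comp_hasMFDerivWithinAt t hγ.hasMFDerivWithinAt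
  have h' : HasFDerivWithinAt (g ∘ γ) (ContinuousLinearMap.comp
      (show E →L[ℝ] ℝ from mvfderiv 𝓘(ℝ, E) g (γ t))
      (show ℝ →L[ℝ] E from mfderivWithin 𝓘(ℝ, ℝ) 𝓘(ℝ, E) γ s t)) s t := h.hasFDerivWithinAt
  exact h'.hasDerivWithinAt

omit [FiniteDimensional ℝ E] in
theorem differentiableWithinAt_velocity_coord {γ : ℝ → M} {s : Set ℝ} (hs : UniqueDiffOn ℝ s)
    (hγ : ContMDiffOn 𝓘(ℝ, ℝ) 𝓘(ℝ, E) ∞ γ s) {t : ℝ} (ht : t ∈ s) :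
    DifferentiableWithinAt ℝ (fun r => (trivializationAt E (TangentSpace 𝓘(ℝ, E)) (γ t)
      ⟨γ r, velocity γ s r⟩).2) s t := by
  have h1 := hγ.contMDiffOn_tangentMapWithin (m := ∞) le_rfl hs.uniqueMDiffOn
  have h0 : ContMDiffOn 𝓘(ℝ, ℝ) (𝓘(ℝ, ℝ).prod 𝓘(ℝ, ℝ)) ∞
      (fun r : ℝ => (⟨r, (1 : ℝ)⟩ : TangentBundle 𝓘(ℝ, ℝ) ℝ)) s := by
    apply (contMDiffOn_vectorSpace_iff_contDiffOn (V := fun _ => (1 : ℝ))).2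
    exact contDiffOn_const
  have h2 := (contMDiffWithinAt_totalSpace.1 ((h1.comp h0 fun r hr => hr) t ht)).2
  exact (h2.mdifferentiableWithinAt (by simp)).differentiableWithinAt

omit [FiniteDimensional ℝ E] in
-- The geodesic equation solved for the derivative of the frame coordinates of γ'.
theorem IsGeodesicOn.exists_hasDerivWithinAt_velocity_coord {γ : ℝ → M} {s : Set ℝ}
    (hs : UniqueDiffOn ℝ s) (hγ : IsGeodesicOn cov γ s) {t : ℝ} (ht : t ∈ s)
    {e : Trivialization E (TotalSpace.proj : TangentBundle 𝓘(ℝ, E) M → M)}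
    (he : e = trivializationAt E (TangentSpace 𝓘(ℝ, E)) (γ t)) :
    ∃ c' : E, HasDerivWithinAt (fun r => (e ⟨γ r, velocity γ s r⟩).2) c' s t ∧
      e.symm (γ t) c'
        = - cov (FiberBundle.extend E (velocity γ s t)) (γ t) (velocity γ s t) := by
  subst he
  exact ⟨_, (differentiableWithinAt_velocity_coord hs hγ.contMDiffOn ht).hasDerivWithinAt,
    eq_neg_of_add_eq_zero_left (hγ.parallel t ht)⟩

end SelfConcordance

namespace SelfConcordance

variable {E : Type*} [NormedAddCommGroup E] [NormedSpace ℝ E] [FiniteDimensional ℝ E]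
  {M : Type*} [TopologicalSpace M] [ChartedSpace E M] [IsManifold 𝓘(ℝ, E) ∞ M]
  (cov : CovariantDerivative 𝓘(ℝ, E) E (TangentSpace 𝓘(ℝ, E) : M → Type _))

omit [FiniteDimensional ℝ E] in
-- Identifies the local extensions in the definition of `hessian` with frame fields of constant
-- coordinates.
theorem extend_trivializationAt_symm {x : M} (a : E) (y : M) :
    FiberBundle.extend E ((trivializationAt E (TangentSpace 𝓘(ℝ, E) : M → Type _) x).symm x a) y
      = (trivializationAt E (TangentSpace 𝓘(ℝ, E) : M → Type _) x).symm y a := by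
  simp only [FiberBundle.extend]
  rw [Trivialization.apply_mk_symm _ (FiberBundle.mem_baseSet_trivializationAt' x)]

/-! ### Derivatives of a function along a geodesic -/

/-- In the frame at γ(t), the product rule gives the derivative of Df on a constant-coordinate field
plus Df on the derivative of the coordinates of γ'. By the geodesic equation the latter is -Df(∇_γ'
V), V being the constant-coordinate extension of γ'(t). -/
theorem IsGeodesicOn.hasDerivWithinAt_mvfderiv {γ : ℝ → M} {s : Set ℝ} (hs : UniqueDiffOn ℝ s)
    (hγ : IsGeodesicOn cov γ s) {f : M → ℝ} {C : Set M} (hC : IsOpen C)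
    (hf : ContMDiffOn 𝓘(ℝ, E) 𝓘(ℝ, ℝ) ∞ f C) {t : ℝ} (ht : t ∈ s) (htC : γ t ∈ C) :
    HasDerivWithinAt (fun r => mvfderiv 𝓘(ℝ, E) f (γ r) (velocity γ s r))
      (hessian cov f (γ t) (velocity γ s t) (velocity γ s t)) s t := by
  set e := trivializationAt E (TangentSpace 𝓘(ℝ, E) : M → Type _) (γ t) with he
  have hmem : γ t ∈ e.baseSet := FiberBundle.mem_baseSet_trivializationAt' (γ t)
  have hγt := hγ.contMDiffOn.mdifferentiableOn (by simp) t ht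
  obtain ⟨c', hc, hc'⟩ := hγ.exists_hasDerivWithinAt_velocity_coord cov hs ht he
  have hbase : ∀ᶠ r in 𝓝[s] t, γ r ∈ e.baseSet :=
    hγt.continuousWithinAt.eventually (e.open_baseSet.mem_nhds hmem)
  have key := hc.linearMap_apply_of_pointwise
    (ℓ := fun r => (mvfderiv 𝓘(ℝ, E) f (γ r)).toLinearMap ∘ₗ e.symmₗ ℝ (γ r))
    (ℓ' := fun a => mvfderiv 𝓘(ℝ, E)
      (fun y => mvfderiv 𝓘(ℝ, E) f y (FiberBundle.extend E (e.symm (γ t) a) y)) (γ t)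
        (velocity γ s t)) (fun a => by
      refine (hasDerivWithinAt_comp_curve (mdifferentiableAt_mvfderiv hC hf htC
        (FiberBundle.mdifferentiableAt_extend 𝓘(ℝ, E) E (e.symm (γ t) a)))
        hγt).congr_of_eventuallyEq_of_mem ?_ ht
      filter_upwards [hbase] with r hr
      rw [LinearMap.comp_apply, e.symmₗ_apply hr, extend_trivializationAt_symm]
      rfl)
  have hu : e.symm (γ t) (e ⟨γ t, velocity γ s t⟩).2 = velocity γ s t :=
    e.symm_apply_apply_mk hmem _
  rw [LinearMap.comp_apply, e.symmₗ_apply hmem, hc', hu] at key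
  refine (key.congr_of_eventuallyEq_of_mem ?_ ht).congr_deriv ?_
  · filter_upwards [hbase] with r hr
    rw [LinearMap.comp_apply, e.symmₗ_apply hr, e.symm_apply_apply_mk hr]
    rfl
  · simp [hessian, sub_eq_add_neg]

theorem IsGeodesicOn.hasDerivWithinAt_hessian [T2Space M] [cov.ContMDiffCovariantDerivative ∞]
    {γ : ℝ → M} {s : Set ℝ} (hs : UniqueDiffOn ℝ s)
    (hγ : IsGeodesicOn cov γ s) {f : M → ℝ} {C : Set M} (hC : IsOpen C)
    (hf : ContMDiffOn 𝓘(ℝ, E) 𝓘(ℝ, ℝ) ∞ f C) {t : ℝ} (ht : t ∈ s) (htC : γ t ∈ C) :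
    HasDerivWithinAt (fun r => hessian cov f (γ r) (velocity γ s r) (velocity γ s r))
      (covDerivHessian cov f (γ t) (velocity γ s t) (velocity γ s t) (velocity γ s t)) s t := by
  classical
  set e := trivializationAt E (TangentSpace 𝓘(ℝ, E) : M → Type _) (γ t) with he
  have hmem : γ t ∈ e.baseSet := FiberBundle.mem_baseSet_trivializationAt' (γ t)
  have hγt := hγ.contMDiffOn.mdifferentiableOn (by simp) t ht
  obtain ⟨c', hc, hc'⟩ := hγ.exists_hasDerivWithinAt_velocity_coord cov hs ht he
  have hbase : ∀ᶠ r in 𝓝[s] t, γ r ∈ e.baseSet :=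
    hγt.continuousWithinAt.eventually (e.open_baseSet.mem_nhds hmem)
  have hbaseC : ∀ᶠ r in 𝓝[s] t, γ r ∈ C := hγt.continuousWithinAt.eventually (hC.mem_nhds htC)
  -- `hessianBilin` needs its base point in `C`; the value 0 elsewhere is harmless, as γ is in `C`
  -- near `t`.
  let h : ℝ → E →ₗ[ℝ] E →ₗ[ℝ] ℝ := fun r => if hr : γ r ∈ C then
    (hessianBilin cov hC hf hr).compl₁₂ (e.symmₗ ℝ (γ r)) (e.symmₗ ℝ (γ r)) else 0
  have h_apply : ∀ r, γ r ∈ C → γ r ∈ e.baseSet → ∀ a b,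
      h r a b = hessian cov f (γ r) (e.symm (γ r) a) (e.symm (γ r) b) := by
    intro r hrC hr a b
    simp only [h, hrC, dif_pos, LinearMap.compl₁₂_apply, e.symmₗ_apply hr]
    rfl
  have key := hc.bilinearMap_apply_of_pointwise (h := h)
    (h' := fun a b => mvfderiv 𝓘(ℝ, E)
      (fun y => hessian cov f y (FiberBundle.extend E (e.symm (γ t) a) y)
        (FiberBundle.extend E (e.symm (γ t) b) y)) (γ t) (velocity γ s t)) (fun a b => by
      refine (hasDerivWithinAt_comp_curve (mdifferentiableAt_hessian_extend cov hC hf htC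
        (e.symm (γ t) a) (e.symm (γ t) b)) hγt).congr_of_eventuallyEq_of_mem ?_ ht
      filter_upwards [hbase, hbaseC] with r hr hrC
      rw [extend_trivializationAt_symm, extend_trivializationAt_symm, h_apply r hrC hr])
  have hu : e.symm (γ t) (e ⟨γ t, velocity γ s t⟩).2 = velocity γ s t :=
    e.symm_apply_apply_mk hmem _
  rw [h_apply t htC hmem, h_apply t htC hmem, hc', hu] at key
  refine (key.congr_of_eventuallyEq_of_mem ?_ ht).congr_deriv ?_
  · filter_upwards [hbase, hbaseC] with r hr hrC
    rw [h_apply r hrC hr, e.symm_apply_apply_mk hr]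
  · have h1 : ∀ v w : TangentSpace 𝓘(ℝ, E) (γ t),
        hessian cov f (γ t) v (-w) = - hessian cov f (γ t) v w :=
      fun v w => (hessianBilin cov hC hf htC v).map_neg w
    have h2 : ∀ v w : TangentSpace 𝓘(ℝ, E) (γ t),
        hessian cov f (γ t) (-v) w = - hessian cov f (γ t) v w :=
      fun v w => (hessianBilin cov hC hf htC).map_neg₂ v w
    rw [h1, h2, covDerivHessian]
    ring

/-! ### The Newton direction -/

/-- Positive definiteness makes u ↦ Hf(u, ·) injective into the dual, hence surjective by equality
of dimensions. -/
theorem IsWeaklySelfConcordant.isNewtonDirection {C : Set M} {f : M → ℝ} {σ : ℝ}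
    (hf : IsWeaklySelfConcordant cov C f σ) {x : M} (hx : x ∈ C) :
    IsNewtonDirection cov f x (newtonDirection cov f x) := by
  have hex : ∃ u : TangentSpace 𝓘(ℝ, E) x, IsNewtonDirection cov f x u := by
    have : FiniteDimensional ℝ (TangentSpace 𝓘(ℝ, E) x) := inferInstanceAs (FiniteDimensional ℝ E)
    let B := hessianBilin cov hf.isOpen hf.smooth hx
    have hinj : Function.Injective B := by
      refine (injective_iff_map_eq_zero B).2 fun u hu => ?_
      by_contra h
      have h0 : B u u = 0 := by rw [hu]; rfl
      exact (hf.nondegenerate x hx u h).ne' h0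
    have hdim : Module.finrank ℝ (TangentSpace 𝓘(ℝ, E) x)
        = Module.finrank ℝ (TangentSpace 𝓘(ℝ, E) x →ₗ[ℝ] ℝ) :=
      (Subspace.dual_finrank_eq (K := ℝ) (V := TangentSpace 𝓘(ℝ, E) x)).symm
    obtain ⟨u, hu⟩ := (LinearMap.injective_iff_surjective_of_finrank_eq_finrank hdim).1 hinj
      (-(mvfderiv 𝓘(ℝ, E) f x).toLinearMap)
    refine ⟨u, fun v => ?_⟩
    have : B u v = - mvfderiv 𝓘(ℝ, E) f x v := by rw [hu]; rfl
    change _ + B u v = 0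
    rw [this, add_neg_cancel]
  rw [newtonDirection, dif_pos hex]
  exact hex.choose_spec

end SelfConcordance

namespace SelfConcordance

/-! ### Scalar self-concordance estimates -/

section Scalar

theorem HasDerivWithinAt.Ici_of_Icc {g : ℝ → ℝ} {g' a b t : ℝ}
    (h : HasDerivWithinAt g g' (Icc a b) t) (ht : t ∈ Ico a b) : HasDerivWithinAt g g' (Ici t) t :=
  h.mono_of_mem_nhdsWithin (Icc_mem_nhdsGE_of_mem ht)

theorem one_sub_mul_pos_of_mem_Icc {k τ t : ℝ} (hk : 0 ≤ k) (h : k * τ < 1) (ht : t ∈ Icc 0 τ) :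
    0 < 1 - k * t := by
  nlinarith [mul_le_mul_of_nonneg_left ht.2 hk]

/-- The barrier solves B' = 2σ'B^(3/2). As σ < σ' and B > 0, a contact point would have q' < B', so
`q` cannot cross. -/
theorem le_sq_div_of_deriv_lt {q q' : ℝ → ℝ} {τ σ σ' r ρ : ℝ} (hσσ' : σ < σ')
    (hσ' : 0 ≤ σ') (hρ : 0 < ρ) (hr : 0 ≤ r) (hrρ : r ≤ ρ) (hτ : σ' * ρ * τ < 1)
    (hq : ∀ t ∈ Icc 0 τ, HasDerivWithinAt q (q' t) (Icc 0 τ) t)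
    (hq' : ∀ t ∈ Icc 0 τ, |q' t| ≤ 2 * σ * (q t) ^ (3 / 2 : ℝ)) (h0 : q 0 ≤ r ^ 2)
    {t : ℝ} (ht : t ∈ Icc 0 τ) : q t ≤ (ρ / (1 - σ' * ρ * t)) ^ 2 := by
  have hk : 0 ≤ σ' * ρ := by positivity
  have hB : ∀ t ∈ Icc 0 τ, HasDerivAt (fun t => (ρ / (1 - σ' * ρ * t)) ^ 2)
      (2 * σ' * (ρ / (1 - σ' * ρ * t)) ^ 3) t := by
    intro t ht
    have hd := one_sub_mul_pos_of_mem_Icc hk hτ ht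
    have h1 : HasDerivAt (fun t => 1 - σ' * ρ * t) (-(σ' * ρ)) t := by
      simpa using ((hasDerivAt_id t).const_mul (σ' * ρ)).const_sub 1
    have h2 := (((hasDerivAt_const t ρ).fun_div h1 hd.ne').fun_pow 2)
    refine h2.congr_deriv ?_
    generalize 1 - σ' * ρ * t = d at hd
    simp only [Nat.cast_ofNat, Nat.add_one_sub_one, pow_one]
    field_simp
    ring
  refine image_le_of_deriv_right_lt_deriv_boundary' (a := 0) (b := τ) (f' := q')
    (B' := fun t => 2 * σ' * (ρ / (1 - σ' * ρ * t)) ^ 3)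
    (fun t ht => (hq t ht).continuousWithinAt)
    (fun t ht => HasDerivWithinAt.Ici_of_Icc (hq t ⟨ht.1, ht.2.le⟩) ht) ?_
    (fun t ht => (hB t ht).continuousAt.continuousWithinAt)
    (fun t ht => (hB t ⟨ht.1, ht.2.le⟩).hasDerivWithinAt) ?_ ht
  · simp only [mul_zero, sub_zero, div_one]
    exact h0.trans (by gcongr)
  · intro t ht heq
    have ht' : t ∈ Icc 0 τ := ⟨ht.1, ht.2.le⟩
    have hpos : 0 < ρ / (1 - σ' * ρ * t) := div_pos hρ (one_sub_mul_pos_of_mem_Icc hk hτ ht')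
    have h1 := (le_abs_self _).trans (hq' t ht')
    have h2 : (q t) ^ (3 / 2 : ℝ) = (ρ / (1 - σ' * ρ * t)) ^ 3 := by
      rw [heq, ← Real.rpow_natCast _ 2, ← Real.rpow_mul hpos.le, ← Real.rpow_natCast _ 3]
      norm_num
    rw [h2] at h1
    refine h1.trans_lt ?_
    have : 0 < (ρ / (1 - σ' * ρ * t)) ^ 3 := by positivity
    nlinarith

/-- Apply the strict comparison to σ + ε and r + ε and let ε → 0⁺; this also covers r = 0. -/
theorem le_sq_div_of_abs_deriv_le {q q' : ℝ → ℝ} {τ σ r : ℝ} (hσ : 0 ≤ σ) (hr : 0 ≤ r)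
    (hτ : σ * r * τ < 1) (hq : ∀ t ∈ Icc 0 τ, HasDerivWithinAt q (q' t) (Icc 0 τ) t)
    (hq' : ∀ t ∈ Icc 0 τ, |q' t| ≤ 2 * σ * (q t) ^ (3 / 2 : ℝ)) (h0 : q 0 ≤ r ^ 2)
    {t : ℝ} (ht : t ∈ Icc 0 τ) : q t ≤ (r / (1 - σ * r * t)) ^ 2 := by
  have hd := one_sub_mul_pos_of_mem_Icc (mul_nonneg hσ hr) hτ ht
  have hlim : Filter.Tendsto (fun ε : ℝ => ((r + ε) / (1 - (σ + ε) * (r + ε) * t)) ^ 2) (𝓝[>] 0)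
      (𝓝 ((r / (1 - σ * r * t)) ^ 2)) := by
    have : ContinuousAt (fun ε : ℝ => ((r + ε) / (1 - (σ + ε) * (r + ε) * t)) ^ 2) 0 := by
      refine ContinuousAt.pow (ContinuousAt.div (by fun_prop) (by fun_prop) ?_) 2
      simpa using hd.ne'
    have h := this.tendsto
    simp only [add_zero] at h
    exact h.mono_left nhdsWithin_le_nhds
  refine ge_of_tendsto hlim ?_
  have hev : ∀ᶠ ε : ℝ in 𝓝[>] 0, (σ + ε) * (r + ε) * τ < 1 := by
    have : ContinuousAt (fun ε : ℝ => (σ + ε) * (r + ε) * τ) 0 := by fun_prop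
    exact (this.eventually_lt continuousAt_const (by simpa using hτ)).filter_mono
      nhdsWithin_le_nhds
  filter_upwards [hev, self_mem_nhdsWithin] with ε hε hε0
  have hε0 : 0 < ε := hε0
  exact le_sq_div_of_deriv_lt (by linarith) (by linarith) (by linarith) hr (by linarith) hε hq hq'
    h0 ht

theorem le_of_abs_third_deriv_le {φ φ₁ φ₂ φ₃ : ℝ → ℝ} {τ σ r : ℝ} (hσ : 0 < σ) (hr : 0 ≤ r)
    (hτ : σ * r * τ < 1) (hφ : ∀ t ∈ Icc 0 τ, HasDerivWithinAt φ (φ₁ t) (Icc 0 τ) t)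
    (hφ₁ : ∀ t ∈ Icc 0 τ, HasDerivWithinAt φ₁ (φ₂ t) (Icc 0 τ) t)
    (hφ₂ : ∀ t ∈ Icc 0 τ, HasDerivWithinAt φ₂ (φ₃ t) (Icc 0 τ) t)
    (hφ₃ : ∀ t ∈ Icc 0 τ, |φ₃ t| ≤ 2 * σ * (φ₂ t) ^ (3 / 2 : ℝ)) (h0 : φ₂ 0 ≤ r ^ 2)
    {t : ℝ} (ht : t ∈ Icc 0 τ) :
    φ t ≤ φ 0 + φ₁ 0 * t + (-(σ * r * t) - Real.log (1 - σ * r * t)) / σ ^ 2 := by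
  have hk : 0 ≤ σ * r := by positivity
  have hd : ∀ t, HasDerivAt (fun t => 1 - σ * r * t) (-(σ * r)) t := fun t => by
    simpa using ((hasDerivAt_id t).const_mul (σ * r)).const_sub 1
  have hB1 : ∀ t ∈ Icc 0 τ, HasDerivAt
      (fun t => φ₁ 0 + (-(σ * r) + σ * r / (1 - σ * r * t)) / σ ^ 2)
      ((r / (1 - σ * r * t)) ^ 2) t := by
    intro t ht
    have hpos := one_sub_mul_pos_of_mem_Icc hk hτ ht
    have h := ((((hasDerivAt_const t (σ * r)).fun_div (hd t) hpos.ne').const_add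
      (-(σ * r))).div_const (σ ^ 2)).const_add (φ₁ 0)
    refine h.congr_deriv ?_
    field_simp
    ring
  have hB : ∀ t ∈ Icc 0 τ, HasDerivAt
      (fun t => φ 0 + φ₁ 0 * t + (-(σ * r * t) - Real.log (1 - σ * r * t)) / σ ^ 2)
      (φ₁ 0 + (-(σ * r) + σ * r / (1 - σ * r * t)) / σ ^ 2) t := by
    intro t ht
    have hpos := one_sub_mul_pos_of_mem_Icc hk hτ ht
    have h := (((hasDerivAt_id t).const_mul (φ₁ 0)).const_add (φ 0)).fun_add
      ((((hasDerivAt_id t).const_mul (σ * r)).fun_neg.fun_sub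
        ((hd t).log hpos.ne')).div_const (σ ^ 2))
    refine h.congr_deriv ?_
    simp only [mul_one]
    ring
  have h1 : ∀ t ∈ Icc 0 τ, φ₁ t ≤ φ₁ 0 + (-(σ * r) + σ * r / (1 - σ * r * t)) / σ ^ 2 := by
    intro t ht
    refine image_le_of_deriv_right_le_deriv_boundary (a := 0) (b := τ) (f' := φ₂)
      (B' := fun t => (r / (1 - σ * r * t)) ^ 2)
      (fun t ht => (hφ₁ t ht).continuousWithinAt)
      (fun t ht => HasDerivWithinAt.Ici_of_Icc (hφ₁ t ⟨ht.1, ht.2.le⟩) ht) (by simp)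
      (fun t ht => (hB1 t ht).continuousAt.continuousWithinAt)
      (fun t ht => (hB1 t ⟨ht.1, ht.2.le⟩).hasDerivWithinAt)
      (fun t ht => le_sq_div_of_abs_deriv_le hσ.le hr hτ hφ₂ hφ₃ h0 ⟨ht.1, ht.2.le⟩) ht
  exact image_le_of_deriv_right_le_deriv_boundary (a := 0) (b := τ) (f' := φ₁)
      (B' := fun t => φ₁ 0 + (-(σ * r) + σ * r / (1 - σ * r * t)) / σ ^ 2)
      (fun t ht => (hφ t ht).continuousWithinAt)
      (fun t ht => HasDerivWithinAt.Ici_of_Icc (hφ t ⟨ht.1, ht.2.le⟩) ht) (by simp)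
      (fun t ht => (hB t ht).continuousAt.continuousWithinAt)
      (fun t ht => (hB t ⟨ht.1, ht.2.le⟩).hasDerivWithinAt)
      (fun t ht => h1 t ⟨ht.1, ht.2.le⟩) ht

end Scalar

end SelfConcordance

namespace SelfConcordance

variable {E : Type*} [NormedAddCommGroup E] [NormedSpace ℝ E]
  {M : Type*} [TopologicalSpace M] [ChartedSpace E M]

/-! ### Staying in the domain -/

/-- A continuous curve starting in `C` along which `f` stays below a continuous function as long
as the curve stays in `C` cannot leave `C` if the epigraph of `f` over `C` is closed. -/
theorem mem_of_isClosed_epigraph {M : Type*} [TopologicalSpace M] {C : Set M} {f : M → ℝ}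
    (hC : IsOpen C) (hepi : IsClosed {p : M × ℝ | p.1 ∈ C ∧ f p.1 ≤ p.2}) {γ : ℝ → M} {b : ℝ}
    (hγ : ContinuousOn γ (Icc 0 b)) (h0 : γ 0 ∈ C) {B : ℝ → ℝ} (hB : ContinuousOn B (Icc 0 b))
    (hle : ∀ τ ∈ Icc 0 b, (∀ t ∈ Icc 0 τ, γ t ∈ C) → f (γ τ) ≤ B τ) :
    ∀ t ∈ Icc 0 b, γ t ∈ C := by
  by_contra! hex
  obtain ⟨t₀, ht₀, ht₀C⟩ := hex
  let K := Icc 0 b ∩ γ ⁻¹' Cᶜ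
  have hK : IsCompact K := by
    refine isCompact_Icc.of_isClosed_subset ?_ inter_subset_left
    exact hγ.preimage_isClosed_of_isClosed isClosed_Icc hC.isClosed_compl
  have hTK : sInf K ∈ K := hK.sInf_mem ⟨t₀, ht₀, ht₀C⟩
  set T := sInf K
  have hbefore : ∀ t ∈ Ico 0 T, γ t ∈ C := by
    intro t ht
    by_contra h
    exact absurd (csInf_le hK.bddBelow (show t ∈ K from ⟨⟨ht.1, ht.2.le.trans hTK.1.2⟩, h⟩))
      (not_le.2 ht.2)
  have hTpos : 0 < T := by
    refine lt_of_le_of_ne hTK.1.1 fun h => hTK.2 ?_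
    rw [← h]
    exact h0
  have hsub : Ico 0 T ⊆ Icc 0 b := fun t ht => ⟨ht.1, ht.2.le.trans hTK.1.2⟩
  have hclos : T ∈ closure (Ico 0 T) := by
    rw [closure_Ico hTpos.ne]
    exact right_mem_Icc.2 hTpos.le
  -- `T` is the first exit time. Before it (γ t, B t) lies in the epigraph, so by closedness the
  -- limit does too, which forces γ T ∈ C.
  have hcont : ContinuousWithinAt (fun t => (γ t, B t)) (Ico 0 T) T :=
    ((hγ T hTK.1).prodMk (hB T hTK.1)).mono hsub
  have hmem := hcont.mem_closure hclos (t := {p : M × ℝ | p.1 ∈ C ∧ f p.1 ≤ p.2}) fun t ht =>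
    ⟨hbefore t ht, hle t (hsub ht) fun r hr => hbefore r ⟨hr.1, hr.2.trans_lt ht.2⟩⟩
  rw [hepi.closure_eq] at hmem
  exact hTK.2 hmem.1

/-! ### Self-concordant functions along geodesics -/

variable [IsManifold 𝓘(ℝ, E) ∞ M] [FiniteDimensional ℝ E] [T2Space M]
  (cov : CovariantDerivative 𝓘(ℝ, E) E (TangentSpace 𝓘(ℝ, E) : M → Type _))
  [cov.ContMDiffCovariantDerivative ∞]

theorem IsWeaklySelfConcordant.geodesic_mem_and_le {C : Set M} {f : M → ℝ} {σ : ℝ} (hσ : 0 < σ)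
    (hf : IsWeaklySelfConcordant cov C f σ) {γ : ℝ → M} (hγ : IsGeodesicOn cov γ (Icc 0 1))
    (h0 : γ 0 ∈ C) {r : ℝ} (hr : 0 ≤ r) (hσr : σ * r < 1)
    (hHr : hessian cov f (γ 0) (velocity γ (Icc 0 1) 0) (velocity γ (Icc 0 1) 0) ≤ r ^ 2) :
    γ 1 ∈ C ∧ f (γ 1) ≤ f (γ 0) + mvfderiv 𝓘(ℝ, E) f (γ 0) (velocity γ (Icc 0 1) 0)
      + (-(σ * r) - Real.log (1 - σ * r)) / σ ^ 2 := by
  let B : ℝ → ℝ := fun t => f (γ 0) + mvfderiv 𝓘(ℝ, E) f (γ 0) (velocity γ (Icc 0 1) 0) * t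
    + (-(σ * r * t) - Real.log (1 - σ * r * t)) / σ ^ 2
  have hle : ∀ τ ∈ Icc (0 : ℝ) 1, (∀ t ∈ Icc 0 τ, γ t ∈ C) → f (γ τ) ≤ B τ := by
    intro τ hτ hmem
    have hsub : Icc 0 τ ⊆ Icc 0 1 := Icc_subset_Icc_right hτ.2
    have huniq : UniqueDiffOn ℝ (Icc (0 : ℝ) 1) := uniqueDiffOn_Icc one_pos
    have hστ : σ * r * τ < 1 :=
      (mul_le_of_le_one_right (mul_nonneg hσ.le hr) hτ.2).trans_lt hσr
    refine le_of_abs_third_deriv_le (φ := fun t => f (γ t)) hσ hr hστ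
      (fun t ht => (hasDerivWithinAt_comp_curve
        ((hf.smooth.contMDiffAt (hf.isOpen.mem_nhds (hmem t ht))).mdifferentiableAt (by simp))
        (hγ.contMDiffOn.mdifferentiableOn (by simp) t (hsub ht))).mono hsub)
      (fun t ht => (hγ.hasDerivWithinAt_mvfderiv cov huniq hf.isOpen hf.smooth (hsub ht)
        (hmem t ht)).mono hsub)
      (fun t ht => (hγ.hasDerivWithinAt_hessian cov huniq hf.isOpen hf.smooth (hsub ht)
        (hmem t ht)).mono hsub)
      (fun t ht => hf.bound _ (hmem t ht) _) hHr (right_mem_Icc.2 hτ.1)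
  have hB : ContinuousOn B (Icc 0 1) := by
    have hne : ∀ t ∈ Icc (0 : ℝ) 1, 1 - σ * r * t ≠ 0 := fun t ht =>
      (one_sub_mul_pos_of_mem_Icc (mul_nonneg hσ.le hr) (by simpa using hσr) ht).ne'
    exact (ContinuousOn.add (by fun_prop) (ContinuousOn.div_const
      (ContinuousOn.sub (by fun_prop) (ContinuousOn.log (by fun_prop) hne)) _))
  have hmem := mem_of_isClosed_epigraph hf.isOpen hf.closed hγ.contMDiffOn.continuousOn h0 hB hle
  have h1 : (1 : ℝ) ∈ Icc (0 : ℝ) 1 := right_mem_Icc.2 zero_le_one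
  exact ⟨hmem 1 h1, by simpa [B] using hle 1 h1 hmem⟩

/-! ### The damped Newton method -/

omit [FiniteDimensional ℝ E] [T2Space M] [cov.ContMDiffCovariantDerivative ∞] in
theorem expMap_eq {x : M} (hx : ExpDefinedAt cov x) (u : TangentSpace 𝓘(ℝ, E) x) :
    ∃ γ : ℝ → M, IsGeodesicFrom cov x u γ ∧ expMap cov x u = γ 1 :=
  ⟨(hx u).choose, (hx u).choose_spec, by rw [expMap, dif_pos (hx u)]⟩

omit [FiniteDimensional ℝ E] [T2Space M] [cov.ContMDiffCovariantDerivative ∞] in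
-- The initial velocity of a geodesic is prescribed only as an equality in the tangent bundle; this
-- transports scalar quantities across it.
theorem hessian_and_mvfderiv_congr (f : M → ℝ) {x y : M} {u : TangentSpace 𝓘(ℝ, E) x}
    {v : TangentSpace 𝓘(ℝ, E) y} (h : (⟨x, u⟩ : TangentBundle 𝓘(ℝ, E) M) = ⟨y, v⟩) :
    hessian cov f x u u = hessian cov f y v v ∧
      mvfderiv 𝓘(ℝ, E) f x u = mvfderiv 𝓘(ℝ, E) f y v := by
  cases h
  exact ⟨rfl, rfl⟩

theorem IsWeaklySelfConcordant.dampedNewton_mem_and_le {C : Set M} {f : M → ℝ} {σ : ℝ}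
    (hσ : 0 < σ) (hf : IsWeaklySelfConcordant cov C f σ) {x : M} (hexp : ExpDefinedAt cov x)
    (hx : x ∈ C) :
    dampedNewton cov σ f x ∈ C ∧
      f (dampedNewton cov σ f x) ≤ f x - 1 / σ ^ 2 * omega (σ * newtonDecrement cov f x) := by
  set u := newtonDirection cov f x
  set l := newtonDecrement cov f x
  have hl0 : 0 ≤ l := Real.sqrt_nonneg _
  have hpos : 0 < 1 + σ * l := by positivity
  have hH0 : 0 ≤ hessian cov f x u u := by
    by_cases h : u = 0
    · have : hessian cov f x u u = 0 := by
        rw [h]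
        exact (hessianBilin cov hf.isOpen hf.smooth hx 0).map_zero
      rw [this]
    · exact (hf.nondegenerate x hx u h).le
  have hl2 : hessian cov f x u u = l ^ 2 := (Real.sq_sqrt hH0).symm
  have hN : mvfderiv 𝓘(ℝ, E) f x u = - l ^ 2 := by
    rw [← hl2]
    exact eq_neg_of_add_eq_zero_left (hf.isNewtonDirection cov hx u)
  set c := (1 + σ * l)⁻¹ with hc
  obtain ⟨γ, ⟨hγ, hγ0⟩, hγ1⟩ := expMap_eq cov hexp (c • u)
  have hbase : γ 0 = x := congrArg TotalSpace.proj hγ0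
  have hHess : hessian cov f (γ 0) (velocity γ (Icc 0 1) 0) (velocity γ (Icc 0 1) 0)
      = (c * l) ^ 2 := by
    have h1 : hessian cov f (γ 0) (velocity γ (Icc 0 1) 0) (velocity γ (Icc 0 1) 0)
        = hessian cov f x (c • u) (c • u) :=
      (hessian_and_mvfderiv_congr cov f hγ0).1
    have h2 : hessian cov f x (c • u) (c • u) = c • c • hessian cov f x u u := by
      have h := (hessianBilin cov hf.isOpen hf.smooth hx).map_smul₂ c u (c • u)
      rw [map_smul (hessianBilin cov hf.isOpen hf.smooth hx u)] at h
      exact h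
    rw [h1, h2, hl2, smul_eq_mul, smul_eq_mul]
    ring
  have hDf : mvfderiv 𝓘(ℝ, E) f (γ 0) (velocity γ (Icc 0 1) 0) = - (c * l ^ 2) := by
    have h1 : mvfderiv 𝓘(ℝ, E) f (γ 0) (velocity γ (Icc 0 1) 0)
        = mvfderiv 𝓘(ℝ, E) f x (c • u) :=
      (hessian_and_mvfderiv_congr cov f hγ0).2
    rw [h1, map_smul, hN, smul_eq_mul]
    ring
  -- This identity explains the damping factor: it gives σr < 1 and turns the logarithm into -log(1
  -- + σλ).
  have hσr : 1 - σ * (c * l) = c := by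
    rw [hc]
    field_simp
    ring
  have hcpos : 0 < c := inv_pos.2 hpos
  have key := hf.geodesic_mem_and_le cov hσ hγ (hbase ▸ hx) (r := c * l) (by positivity)
    (by linarith) hHess.le
  rw [← hγ1, hDf, hbase, hσr] at key
  refine ⟨key.1, key.2.trans_eq ?_⟩
  rw [hc, Real.log_inv, omega]
  field_simp
  ring

/-! ### The function ω and the iteration count -/

theorem omega_pos {β : ℝ} (hβ : 0 < β) : 0 < omega β := by
  have := Real.log_lt_sub_one_of_pos (x := 1 + β) (by linarith) (by linarith)
  rw [omega]
  linarith

/-- Uses log y ≤ y - 1 at y = (1 + b)/(1 + a). -/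
theorem omega_le_omega {a b : ℝ} (ha : 0 ≤ a) (hab : a ≤ b) : omega a ≤ omega b := by
  have h1 : 0 < 1 + a := by linarith
  have h2 : 0 < 1 + b := by linarith
  have h := Real.log_le_sub_one_of_pos (div_pos h2 h1)
  rw [Real.log_div h2.ne' h1.ne'] at h
  have h3 : (1 + b) / (1 + a) - 1 ≤ b - a := by
    rw [div_sub_one h1.ne', div_le_iff₀ h1]
    nlinarith
  rw [omega, omega]
  linarith

/-- If each step from a point of `C` with `β ≤ g` decreases `f` by at least `δ`, a point with
`g < β` is reached within `(f x₀ - inf f) / δ` steps. -/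
theorem exists_iterate_lt_of_decrease {X : Type*} {C : Set X} {f g : X → ℝ} {N : X → X} {β δ : ℝ}
    (hδ : 0 < δ) (hN : ∀ x ∈ C, N x ∈ C) (hdec : ∀ x ∈ C, β ≤ g x → f (N x) ≤ f x - δ)
    (hbdd : BddBelow (f '' C)) {x₀ : X} (hx₀ : x₀ ∈ C) :
    ∃ k : ℕ, (k : ℝ) ≤ (f x₀ - sInf (f '' C)) / δ ∧ N^[k] x₀ ∈ C ∧ g (N^[k] x₀) < β := by
  have hmem : ∀ k, N^[k] x₀ ∈ C := by
    intro k
    induction k with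
    | zero => exact hx₀
    | succ k ih => rw [Function.iterate_succ_apply']; exact hN _ ih
  have hinf : ∀ k, sInf (f '' C) ≤ f (N^[k] x₀) := fun k => csInf_le hbdd ⟨_, hmem k, rfl⟩
  by_contra! hno
  -- The `+ 1` lets the induction reach ⌊R⌋ + 1, R being the claimed bound: passing from k to k + 1
  -- uses `hno` only at k ≤ R.
  have hdecr : ∀ k : ℕ, (k : ℝ) ≤ (f x₀ - sInf (f '' C)) / δ + 1 →
      f (N^[k] x₀) ≤ f x₀ - k * δ := by
    intro k
    induction k with
    | zero => intro _; simp
    | succ k ih =>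
      intro hk
      push_cast at hk ⊢
      have h1 := ih (by linarith)
      have h2 := hdec _ (hmem k) (hno k (by linarith) (hmem k))
      rw [Function.iterate_succ_apply']
      linarith
  set R := (f x₀ - sInf (f '' C)) / δ
  have hR0 : 0 ≤ R := div_nonneg (sub_nonneg.2 (hinf 0)) hδ.le
  -- More than R decreases by `δ` would push `f` below its infimum.
  have h1 := hdecr (⌊R⌋₊ + 1) (by push_cast; linarith [Nat.floor_le hR0])
  have h2 := hinf (⌊R⌋₊ + 1)
  have h3 : R * δ = f x₀ - sInf (f '' C) := div_mul_cancel₀ _ hδ.ne'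
  have h4 := mul_lt_mul_of_pos_right (Nat.lt_floor_add_one R) hδ
  push_cast at h1
  linarith

end SelfConcordance

theorem mainTheorem9 {E : Type*} [NormedAddCommGroup E] [NormedSpace ℝ E] [FiniteDimensional ℝ E]
    {M : Type*} [TopologicalSpace M] [T2Space M] [ChartedSpace E M] [IsManifold 𝓘(ℝ, E) ∞ M]
    (cov : CovariantDerivative 𝓘(ℝ, E) E (TangentSpace 𝓘(ℝ, E) : M → Type _))
    [CovariantDerivative.ContMDiffCovariantDerivative cov ∞]
    (h_torsion : cov.torsion = 0)
    (h_exp : ∀ x : M, SelfConcordance.ExpDefinedAt cov x)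
    (h_surj : ∀ x : M, Function.Surjective (SelfConcordance.expMap cov x))
    (C : Set M) (f : M → ℝ) (σ : ℝ) (hσ : 0 < σ)
    (hf : SelfConcordance.IsWeaklySelfConcordant cov C f σ) :
    (∀ x ∈ C,
      SelfConcordance.IsNewtonDirection cov f x (SelfConcordance.newtonDirection cov f x) ∧
      SelfConcordance.dampedNewton cov σ f x ∈ C ∧
      f (SelfConcordance.dampedNewton cov σ f x) ≤
        f x - 1 / σ ^ 2 *
          SelfConcordance.omega (σ * SelfConcordance.newtonDecrement cov f x)) ∧
    (BddBelow (f '' C) → ∀ x₀ ∈ C, ∀ β : ℝ, 0 < β →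
      ∃ k : ℕ,
        (k : ℝ) ≤ σ ^ 2 * (f x₀ - sInf (f '' C)) / SelfConcordance.omega β ∧
        (SelfConcordance.dampedNewton cov σ f)^[k] x₀ ∈ C ∧
        SelfConcordance.newtonDecrement cov f ((SelfConcordance.dampedNewton cov σ f)^[k] x₀)
          < β / σ) := by
  have hstep := fun x (hx : x ∈ C) => hf.dampedNewton_mem_and_le cov hσ (h_exp x) hx
  refine ⟨fun x hx => ⟨hf.isNewtonDirection cov hx, hstep x hx⟩, fun hbdd x₀ hx₀ β hβ => ?_⟩
  have hω := SelfConcordance.omega_pos hβ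
  obtain ⟨k, hk, hkC, hkβ⟩ := SelfConcordance.exists_iterate_lt_of_decrease
    (g := SelfConcordance.newtonDecrement cov f) (β := β / σ)
    (δ := 1 / σ ^ 2 * SelfConcordance.omega β) (by positivity) (fun x hx => (hstep x hx).1)
    (fun x hx hβx => (hstep x hx).2.trans (by
      gcongr
      exact SelfConcordance.omega_le_omega hβ.le ((div_le_iff₀' hσ).1 hβx))) hbdd hx₀
  refine ⟨k, hk.trans_eq ?_, hkC, hkβ⟩
  field_simp
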